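/- Let $K$ be an infinite field, $A=K[X_1,\ldots,X_n]$, and let $\mathrm{GL}_n(K)$ act on $A$ by linear changes of coordinates: $g=(g_{ij})$ acts as the $K$-algebra automorphism with $gX_j=\sum_{i=1}^n g_{ij}X_i$ for $j=1,\ldots,n$. For a weight $\omega=(\omega_1,\ldots,\omega_n)\in\mathbb{R}^n$, the initial form $\mathrm{in}_\omega(f)$ of $f\in A$ is the sum of those terms $\alpha_a X^a$ of $f$ for which $\omega\cdot a$ is maximal, and $\mathrm{in}_\omega(J)$ is the ideal generated by the initial forms of all elements of an ideal $J$. Let $I\subseteq A$ be a homogeneous ideal and let $\omega\in\mathbb{R}^n$ be a weight with $\omega_1\geq\cdots\geq\omega_n$. Let $\mathcal{B}_\omega\subseteq\mathrm{GL}_n(K)$ be the group of upper triangular matrices $(m_{ij})$ with $m_{ii}=1$ for all $i$ and $m_{ij}=0$ whenever $i\neq j$ and $\omega_i=\omega_j$. Then there is a non-empty Zariski open set $U\subseteq\mathrm{GL}_n(K)$ such that $$b\bigl(\mathrm{in}_\omega(gI)\bigr)=\mathrm{in}_\omega(gI)\qquad\text{for all } g\in U \text{ and all } b\in\mathcal{B}_\omega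 .$$ -/

import Mathlib

open MvPolynomial Matrix

attribute [local instance] MvPolynomial.gradedAlgebra

namespace WeightInitial

section Defs

variable {K : Type*} [Field K] {n : ℕ}

open Classical in
/-- The initial form of `f` with respect to the weight `ω ∈ ℝⁿ`: the sum of all terms of `f` whose
weight `ω ⬝ a = ∑ i, a i * ω i` is maximal among the terms of `f` (and `0` when `f = 0`). -/
noncomputable def initialForm (ω : Fin n → ℝ) (f : MvPolynomial (Fin n) K) :
    MvPolynomial (Fin n) K :=
  ∑ a ∈ f.support with ∀ c ∈ f.support, Finsupp.weight ω c ≤ Finsupp.weight ω a,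
    monomial a (coeff a f)

/-- The initial ideal of `I` with respect to `ω`: the ideal generated by the initial forms of all
elements of `I`. -/
noncomputable def initialIdeal (ω : Fin n → ℝ) (I : Ideal (MvPolynomial (Fin n) K)) :
    Ideal (MvPolynomial (Fin n) K) :=
  Ideal.span (initialForm ω '' (I : Set (MvPolynomial (Fin n) K)))

/-- The linear change of coordinates `X_j ↦ ∑ i, g i j * X_i` attached to an invertible matrix: on
linear forms, `g` is the matrix of this map in the basis of the variables. In particular, an
upper triangular `g` sends `X_j` to a combination of `X_1, …, X_j`. -/
noncomputable def coordChange (g : GL (Fin n) K) :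
    MvPolynomial (Fin n) K →ₐ[K] MvPolynomial (Fin n) K :=
  aeval fun j => ∑ i, C (g i j) * X i

/-- Zariski open subsets of `GL_n(K) ⊆ K^(n × n)`: complements of the common zero locus in
`GL_n(K)` of a set of polynomials in the matrix entries. -/
def IsZariskiOpen (U : Set (GL (Fin n) K)) : Prop :=
  ∃ S : Set (MvPolynomial (Fin n × Fin n) K),
    U = {g | ∃ p ∈ S, eval (fun ij : Fin n × Fin n => g ij.1 ij.2) p ≠ 0}

/-- The group of upper triangular matrices with ones on the diagonal and with `m i j = 0` whenever
`i ≠ j` and `ω i = ω j`, for a weight `ω 1 ≥ ⋯ ≥ ω n`. -/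
def weightBorel (K : Type*) [Field K] (ω : Fin n → ℝ) (hω : Antitone ω) :
    Subgroup (GL (Fin n) K) where
  carrier := {m | (∀ i j, j < i → m i j = 0) ∧ (∀ i, m i i = 1) ∧
    ∀ i j, i ≠ j → ω i = ω j → m i j = 0}
  one_mem' := by
    refine ⟨fun i j h => ?_, fun i => ?_, fun i j h _ => ?_⟩
    · simp [h.ne']
    · simp
    · simp [h]
  mul_mem' := by
    rintro a b ⟨a1, a2, a3⟩ ⟨b1, b2, b3⟩
    refine ⟨fun i j h => ?_, fun i => ?_, fun i j h e => ?_⟩ <;>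
      simp only [Units.val_mul, Matrix.mul_apply]
    · refine Finset.sum_eq_zero fun k _ => ?_
      rcases lt_or_ge k i with hk | hk
      · rw [a1 i k hk, zero_mul]
      · rw [b1 k j (h.trans_le hk), mul_zero]
    · rw [Finset.sum_eq_single i, a2, b2, one_mul]
      · intro k _ hk
        rcases lt_or_gt_of_ne hk with hk | hk
        · rw [a1 i k hk, zero_mul]
        · rw [b1 k i hk, mul_zero]
      · simp
    · refine Finset.sum_eq_zero fun k _ => ?_
      rcases lt_or_ge k i with hk | hk
      · rw [a1 i k hk, zero_mul]
      rcases lt_or_ge j k with hj | hj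
      · rw [b1 k j hj, mul_zero]
      have e1 : ω i = ω k := le_antisymm (e.trans_le (hω hj)) (hω hk)
      by_cases hik : i = k
      · subst hik
        rw [b3 i j h e, mul_zero]
      · rw [a3 i k hik e1, zero_mul]
  inv_mem' := by
    rintro a ⟨a1, a2, a3⟩
    have key : ∀ i j, ω i ≤ ω j → i ≠ j → a i j = 0 := by
      intro i j h hij
      rcases lt_or_gt_of_ne hij with h1 | h1
      · exact a3 i j hij (le_antisymm h (hω h1.le))
      · exact a1 i j h1
    have bt : BlockTriangular (a : Matrix (Fin n) (Fin n) K) (fun i => OrderDual.toDual (ω i)) := by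
      intro i j h
      have h' : ω i < ω j := h
      exact key i j h'.le (fun e => by subst e; exact lt_irrefl _ h')
    have : Invertible (a : Matrix (Fin n) (Fin n) K) := a.invertible
    have bi := blockTriangular_inv_of_blockTriangular bt
    rw [← Matrix.coe_units_inv] at bi
    have main : ∀ i j, ω i = ω j → (a⁻¹ : GL (Fin n) K) i j = (1 : Matrix (Fin n) (Fin n) K) i j := by
      intro i j e
      have h1 : (a : Matrix (Fin n) (Fin n) K) * ((a⁻¹ : GL (Fin n) K) : Matrix _ _ K) = 1 := by
        rw [← Units.val_mul, mul_inv_cancel, Units.val_one]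
      rw [← h1, Matrix.mul_apply, Finset.sum_eq_single i, a2, one_mul]
      · intro k _ hk
        rcases le_or_gt (ω i) (ω k) with h | h
        · rw [key i k h hk.symm, zero_mul]
        · rw [bi (show OrderDual.toDual (ω j) < OrderDual.toDual (ω k) from e ▸ h), mul_zero]
      · simp
    refine ⟨fun i j h => ?_, fun i => ?_, fun i j h e => ?_⟩
    · rcases (hω h.le).lt_or_eq with h' | h'
      · exact bi (show OrderDual.toDual (ω j) < OrderDual.toDual (ω i) from h')
      · rw [main i j h', Matrix.one_apply_ne h.ne']
    · rw [main i i rfl, Matrix.one_apply_eq]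
    · rw [main i j e, Matrix.one_apply_ne h]

end Defs

end WeightInitial

namespace WeightInitial

variable {K : Type*} [Field K] {n : ℕ}

/-! ### Linear changes of coordinates -/

/-! Measure an ideal `J` by its coefficient ranks: for a finite set `T` of exponents, `coeffRank J
T` is the dimension of the image of `J` in `K^T`. On the orbit of `I` each rank is maximal on a
non-empty open set, being governed by minors polynomial in the entries of `g`. When `T` is a final
segment, in some degree, of a term order refining `ω`, the rank counts the leading exponents in `T`
(`coeffRank_eq_card`); Dickson's lemma then makes one open set serve all degrees at once
(`exists_isGenericAt_isFinalSegment`).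

For such `g` put `J = gI`. Since `in_ω J` is a torus degeneration of `J`, each rank of `b(in_ω J)`
is at most the rank of some translate of `J` (`exists_coeffRank_initialIdeal_le`). Genericity bounds
this by the rank of `J`, which on final segments is at most that of `in_ω J`. So `b` does not
increase these ranks (`coeffRank_map_initialIdeal_le`).

Now let `f` be an initial form of degree `d` and weight `w`, and `T` the exponents of degree `d` and
weight above `w`. As `b` only adds terms of higher weight, `bf - f` lives on `T`. The rank bound
forces `bf - f = bp` with `p` a combination of initial forms of weight above `w`, and induction on
the weight gives `bf ∈ in_ω J` (`coordChange_initialForm_mem`). -/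

theorem coordChange_X (g : GL (Fin n) K) (j : Fin n) :
    coordChange g (X j) = ∑ i, C (g i j) * X i := by
  simp [coordChange]

theorem coordChange_one : coordChange (1 : GL (Fin n) K) = AlgHom.id K _ := by
  ext1 j
  rw [coordChange_X, Finset.sum_eq_single j]
  · simp
  · intro i _ hi
    simp [Matrix.one_apply_ne hi]
  · simp

theorem coordChange_mul (g h : GL (Fin n) K) :
    coordChange (g * h) = (coordChange g).comp (coordChange h) := by
  ext1 j
  simp only [AlgHom.comp_apply, coordChange_X, map_sum, map_mul, Units.val_mul, Matrix.mul_apply,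
    algHom_C, Finset.mul_sum, Finset.sum_mul, algebraMap_eq]
  rw [Finset.sum_comm]
  refine Finset.sum_congr rfl fun i _ => Finset.sum_congr rfl fun k _ => ?_
  ring

theorem coordChange_inv_apply (g : GL (Fin n) K) (f : MvPolynomial (Fin n) K) :
    coordChange g⁻¹ (coordChange g f) = f := by
  rw [← AlgHom.comp_apply, ← coordChange_mul, inv_mul_cancel, coordChange_one, AlgHom.id_apply]

theorem coordChange_apply_inv (g : GL (Fin n) K) (f : MvPolynomial (Fin n) K) :
    coordChange g (coordChange g⁻¹ f) = f := by
  rw [← AlgHom.comp_apply, ← coordChange_mul, mul_inv_cancel, coordChange_one, AlgHom.id_apply]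

theorem coordChange_injective (g : GL (Fin n) K) : Function.Injective (coordChange g) :=
  Function.LeftInverse.injective (coordChange_inv_apply g)

theorem coordChange_surjective (g : GL (Fin n) K) : Function.Surjective (coordChange g) :=
  Function.RightInverse.surjective (coordChange_apply_inv g)

theorem mem_map_coordChange {J : Ideal (MvPolynomial (Fin n) K)} {g : GL (Fin n) K}
    {f : MvPolynomial (Fin n) K} :
    f ∈ J.map (coordChange g) ↔ ∃ f' ∈ J, coordChange g f' = f :=
  Ideal.mem_map_iff_of_surjective _ (coordChange_surjective g)

theorem map_coordChange_mul (J : Ideal (MvPolynomial (Fin n) K)) (g h : GL (Fin n) K) :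
    (J.map (coordChange h)).map (coordChange g) = J.map (coordChange (g * h)) := by
  rw [coordChange_mul]
  exact Ideal.map_map (coordChange h).toRingHom (coordChange g).toRingHom

theorem isHomogeneous_coordChange (g : GL (Fin n) K) {f : MvPolynomial (Fin n) K} {d : ℕ}
    (hf : f.IsHomogeneous d) : (coordChange g f).IsHomogeneous d := by
  have := hf.aeval (fun j => ∑ i, C (g i j) * X i : Fin n → MvPolynomial (Fin n) K) (n := 1)
    fun j => IsHomogeneous.sum _ _ _ fun i _ => by
      simpa using (isHomogeneous_C (Fin n) (g i j)).mul (isHomogeneous_X K i)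
  simpa [coordChange] using this

theorem homogeneousComponent_coordChange (g : GL (Fin n) K) (f : MvPolynomial (Fin n) K) (d : ℕ) :
    homogeneousComponent d (coordChange g f) = coordChange g (homogeneousComponent d f) := by
  conv_lhs => rw [← sum_homogeneousComponent f, map_sum, map_sum]
  have key : ∀ i, homogeneousComponent d (coordChange g (homogeneousComponent i f)) =
      if i = d then coordChange g (homogeneousComponent d f) else 0 := by
    intro i
    rw [homogeneousComponent_of_mem
      (isHomogeneous_coordChange g (homogeneousComponent_isHomogeneous i f))]
    split_ifs with h1 h2 h2 <;> simp_all
  simp only [key, Finset.sum_ite_eq', Finset.mem_range]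
  split_ifs with h
  · rfl
  · rw [homogeneousComponent_eq_zero _ _ (by omega), map_zero]

/-- An ideal closed under taking homogeneous components. -/
def ComponentClosed (J : Ideal (MvPolynomial (Fin n) K)) : Prop :=
  ∀ f ∈ J, ∀ d, homogeneousComponent d f ∈ J

theorem ComponentClosed.map_coordChange {J : Ideal (MvPolynomial (Fin n) K)}
    (hJ : ComponentClosed J) (g : GL (Fin n) K) : ComponentClosed (J.map (coordChange g)) := by
  intro f hf d
  obtain ⟨f', hf', rfl⟩ := mem_map_coordChange.1 hf
  rw [homogeneousComponent_coordChange]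
  exact Ideal.mem_map_of_mem _ (hJ f' hf' d)

/-- A unipotent change of coordinates only adds terms of higher weight to a monomial. -/
theorem lt_weight_of_mem_support_coordChange_sub {ω : Fin n → ℝ} {hω : Antitone ω}
    {b : GL (Fin n) K} (hb : b ∈ weightBorel K ω hω) (a : Fin n →₀ ℕ) :
    ∀ m ∈ (coordChange b (monomial a 1) - monomial a 1).support,
      Finsupp.weight ω a < Finsupp.weight ω m := by
  obtain ⟨b1, b2, b3⟩ := hb
  have hX : ∀ j, ∀ m ∈ (coordChange b (X j) - X j).support, ω j < Finsupp.weight ω m := by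
    intro j m hm
    classical
    have e : coordChange b (X j) - X j =
        ∑ i ∈ Finset.univ.erase j, monomial (fun₀ | i => 1) (b i j) := by
      rw [coordChange_X, ← Finset.add_sum_erase _ _ (Finset.mem_univ j), b2]
      simp [C_mul_X_eq_monomial]
    rw [e] at hm
    obtain ⟨i, hi, him⟩ := Finset.mem_biUnion.1 (support_sum hm)
    rw [mem_support_iff, coeff_monomial] at him
    split_ifs at him with h
    · rw [← h, Finsupp.weight_single, one_smul]
      have hij : i ≠ j := Finset.ne_of_mem_erase hi
      rcases lt_or_gt_of_ne hij with h1 | h1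
      · exact lt_of_le_of_ne (hω h1.le) fun e => him (b3 i j hij e.symm)
      · exact absurd (b1 i j h1) him
    · exact absurd rfl him
  -- The property passes to products of monomials: with `b x^a = x^a + u` and `b x^c = x^c + v`, the
  -- error term is `uv + u x^c + x^a v`. This reduces everything to the variables.
  have hadd : ∀ a c : Fin n →₀ ℕ,
      (∀ m ∈ (coordChange b (monomial a 1) - monomial a 1).support,
        Finsupp.weight ω a < Finsupp.weight ω m) →
      (∀ m ∈ (coordChange b (monomial c 1) - monomial c 1).support,
        Finsupp.weight ω c < Finsupp.weight ω m) →
      ∀ m ∈ (coordChange b (monomial (a + c) 1) - monomial (a + c) 1).support,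
        Finsupp.weight ω (a + c) < Finsupp.weight ω m := by
    classical
    intro a c ha hc m hm
    have e : coordChange b (monomial (a + c) 1) - monomial (a + c) 1 =
        (coordChange b (monomial a 1) - monomial a 1) * (coordChange b (monomial c 1) -
          monomial c 1) + (coordChange b (monomial a 1) - monomial a 1) * monomial c 1 +
        monomial a 1 * (coordChange b (monomial c 1) - monomial c 1) := by
      rw [← one_mul (1 : K), ← monomial_mul, map_mul, one_mul]
      ring
    rw [e] at hm
    rw [map_add]
    have hmon : ∀ {q : Fin n →₀ ℕ} {a : Fin n →₀ ℕ}, q ∈ (monomial a (1 : K)).support → q = a :=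
      fun h => Finset.mem_singleton.1 (support_monomial_subset h)
    rcases Finset.mem_union.1 (support_add hm) with h | h
    · rcases Finset.mem_union.1 (support_add h) with h | h <;>
      obtain ⟨p, hp, q, hq, rfl⟩ := Finset.mem_add.1 (support_mul _ _ h)
      · rw [map_add]
        exact add_lt_add (ha p hp) (hc q hq)
      · rw [map_add, hmon hq]
        exact add_lt_add_left (ha p hp) _
    · obtain ⟨p, hp, q, hq, rfl⟩ := Finset.mem_add.1 (support_mul _ _ h)
      rw [map_add, hmon hp]
      exact add_lt_add_right (hc q hq) _
  induction a using Finsupp.induction_linear with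
  | zero => simp
  | add a c ha hc => exact hadd a c ha hc
  | single j k =>
    induction k with
    | zero => simp
    | succ k ih =>
      rw [Finsupp.single_add]
      refine hadd _ _ ih ?_
      intro m hm
      rw [Finsupp.weight_single, one_smul]
      exact hX j m hm

/-! ### Ranks of coefficient vectors -/

/-- The coefficients of a polynomial at a finite set of exponents. -/
noncomputable def coeffVec (T : Finset (Fin n →₀ ℕ)) : MvPolynomial (Fin n) K →ₗ[K] (T → K) :=
  LinearMap.pi fun m => lcoeff K (m : Fin n →₀ ℕ)

@[simp]
theorem coeffVec_apply (T : Finset (Fin n →₀ ℕ)) (f : MvPolynomial (Fin n) K) (m : T) :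
    coeffVec T f m = coeff m f := rfl

/-- The dimension of the space of coefficient vectors at `T` of the elements of `J`. -/
noncomputable def coeffRank (J : Ideal (MvPolynomial (Fin n) K)) (T : Finset (Fin n →₀ ℕ)) : ℕ :=
  Module.finrank K ((J.restrictScalars K).map (coeffVec T))

theorem coeffRank_le_card (J : Ideal (MvPolynomial (Fin n) K)) (T : Finset (Fin n →₀ ℕ)) :
    coeffRank J T ≤ T.card := by
  refine (Submodule.finrank_le _).trans ?_
  simp

theorem card_le_coeffRank {ι : Type*} [Fintype ι] {J : Ideal (MvPolynomial (Fin n) K)}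
    {T : Finset (Fin n →₀ ℕ)} {f : ι → MvPolynomial (Fin n) K} (hf : ∀ i, f i ∈ J)
    (hind : LinearIndependent K fun i => coeffVec T (f i)) : Fintype.card ι ≤ coeffRank J T := by
  rw [← finrank_span_eq_card hind]
  refine Submodule.finrank_mono (Submodule.span_le.2 ?_)
  rintro _ ⟨i, rfl⟩
  exact ⟨f i, hf i, rfl⟩

/-- A basis of the coefficient space can be picked from the images of any `K`-spanning set. Allowing
an arbitrary `S` matters for the initial ideal, where the chosen elements must be genuine initial
forms. -/
theorem exists_linearIndependent_coeffVec {J : Ideal (MvPolynomial (Fin n) K)}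
    {S : Set (MvPolynomial (Fin n) K)} (hS : J.restrictScalars K = Submodule.span K S)
    (φ : MvPolynomial (Fin n) K →ₗ[K] MvPolynomial (Fin n) K)
    {J' : Ideal (MvPolynomial (Fin n) K)} (hJ' : J'.restrictScalars K = (J.restrictScalars K).map φ)
    (T : Finset (Fin n →₀ ℕ)) :
    ∃ f : Fin (coeffRank J' T) → MvPolynomial (Fin n) K, (∀ i, f i ∈ S) ∧
      LinearIndependent K fun i => coeffVec T (φ (f i)) := by
  have e : (J'.restrictScalars K).map (coeffVec T) =
      Submodule.span K ((fun f => coeffVec T (φ f)) '' S) := by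
    rw [hJ', hS, Submodule.map_span, Submodule.map_span, Set.image_image]
  obtain ⟨v, hv, -, hind⟩ :=
    Submodule.exists_fun_fin_finrank_span_eq K ((fun f => coeffVec T (φ f)) '' S)
  choose f hf hfv using hv
  have : coeffRank J' T = Module.finrank K
      (Submodule.span K ((fun f => coeffVec T (φ f)) '' S)) := by
    rw [coeffRank, e]
  rw [this]
  exact ⟨f, hf, by simpa only [hfv] using hind⟩

theorem restrictScalars_map_coordChange (J : Ideal (MvPolynomial (Fin n) K)) (g : GL (Fin n) K) :
    (J.map (coordChange g)).restrictScalars K =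
      (J.restrictScalars K).map (coordChange g).toLinearMap := by
  ext f
  rw [Submodule.restrictScalars_mem, mem_map_coordChange]
  rfl

/-- With the next lemma this turns linear independence into the non-vanishing of a determinant, an
open condition once `v` varies. -/
theorem exists_dual_family {V : Type*} [AddCommGroup V] [Module K V] {k : ℕ} {v : Fin k → V}
    (hv : LinearIndependent K v) :
    ∃ l : V →ₗ[K] (Fin k → K), (Matrix.of fun i => l (v i)) = 1 := by
  obtain ⟨l, hl⟩ := LinearMap.exists_leftInverse_of_injective (Fintype.linearCombination K v)
    (LinearMap.ker_eq_bot.2 (linearIndependent_iff_injective_fintypeLinearCombination.1 hv))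
  refine ⟨l, ?_⟩
  ext i j
  have := LinearMap.congr_fun hl (Pi.single i 1)
  simp only [LinearMap.comp_apply, Fintype.linearCombination_apply_single, one_smul,
    LinearMap.id_apply] at this
  rw [Matrix.of_apply, this, Matrix.one_apply, Pi.single_apply]
  simp only [eq_comm]

theorem linearIndependent_of_det_ne_zero {V : Type*} [AddCommGroup V] [Module K V] {k : ℕ}
    {v : Fin k → V} (l : V →ₗ[K] (Fin k → K)) (h : (Matrix.of fun i => l (v i)).det ≠ 0) :
    LinearIndependent K v := by
  have := Matrix.linearIndependent_rows_of_det_ne_zero h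
  exact LinearIndependent.of_comp l this

/-! ### Genericity -/

/-- The coordinate change attached to the generic matrix. -/
noncomputable def genericChange :
    MvPolynomial (Fin n) K →ₐ[K] MvPolynomial (Fin n) (MvPolynomial (Fin n × Fin n) K) :=
  aeval fun j => ∑ i, C (X (i, j)) * X i

/-- Evaluation of a polynomial in the entries of a matrix. -/
noncomputable abbrev evalGL (g : GL (Fin n) K) : MvPolynomial (Fin n × Fin n) K →+* K :=
  eval fun ij : Fin n × Fin n => g ij.1 ij.2

theorem map_evalGL_genericChange (g : GL (Fin n) K) (f : MvPolynomial (Fin n) K) :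
    map (evalGL g) (genericChange f) = coordChange g f := by
  induction f using MvPolynomial.induction_on with
  | C a =>
    rw [algHom_C, algHom_C]
    simp [MvPolynomial.algebraMap_apply, algebraMap_eq]
  | add p q hp hq => rw [map_add, map_add, hp, hq, map_add]
  | mul_X p i hp =>
    rw [map_mul, map_mul, hp, map_mul, coordChange_X]
    simp [genericChange]

theorem eval_coeff_genericChange (g : GL (Fin n) K) (f : MvPolynomial (Fin n) K)
    (m : Fin n →₀ ℕ) : evalGL g (coeff m (genericChange f)) = coeff m (coordChange g f) := by
  rw [← map_evalGL_genericChange, coeff_map]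

theorem exists_evalGL_ne_zero [Infinite K] {P : MvPolynomial (Fin n × Fin n) K} (hP : P ≠ 0) :
    ∃ g : GL (Fin n) K, evalGL g P ≠ 0 := by
  by_contra! h
  exact hP (eq_of_eval_eq_on_gl fun g => by rw [map_zero]; exact h g)

/-- The orbit of `I` has largest possible coefficient rank at `T` in `g`. -/
def IsGenericAt (I : Ideal (MvPolynomial (Fin n) K)) (T : Finset (Fin n →₀ ℕ))
    (g : GL (Fin n) K) : Prop :=
  ∀ h : GL (Fin n) K, coeffRank (I.map (coordChange h)) T ≤ coeffRank (I.map (coordChange g)) T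

/-- Take elements of `I` whose images under a rank-maximizing `h₀` have independent coefficient
vectors. The minor detecting this is a polynomial in the matrix entries, and wherever it is non-zero
the maximal rank is attained. -/
theorem exists_isGenericAt_of_evalGL_ne_zero (I : Ideal (MvPolynomial (Fin n) K))
    (T : Finset (Fin n →₀ ℕ)) :
    ∃ P : MvPolynomial (Fin n × Fin n) K, P ≠ 0 ∧ ∀ g, evalGL g P ≠ 0 → IsGenericAt I T g := by
  let rk : GL (Fin n) K → ℕ := fun h => coeffRank (I.map (coordChange h)) T
  obtain ⟨h₀, hmax⟩ : ∃ h₀, ∀ h, rk h ≤ rk h₀ := by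
    -- Ranks are bounded by `T.card`, so a maximal rank is a minimal corank.
    refine ⟨Function.argmin fun h => T.card - rk h, fun h => ?_⟩
    have h1 := Function.argmin_le (fun h => T.card - rk h) h
    have h2 := coeffRank_le_card (I.map (coordChange h)) T
    have h3 : rk h ≤ T.card := h2
    omega
  obtain ⟨f, hfI, hind⟩ := exists_linearIndependent_coeffVec (J := I) (S := I)
    (Submodule.span_eq (I.restrictScalars K)).symm
    (coordChange h₀).toLinearMap (restrictScalars_map_coordChange I h₀) T
  obtain ⟨l, hl⟩ := exists_dual_family hind
  let A : Matrix (Fin (coeffRank (I.map (coordChange h₀)) T))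
      (Fin (coeffRank (I.map (coordChange h₀)) T)) (MvPolynomial (Fin n × Fin n) K) :=
    Matrix.of fun i j => ∑ m : T, C (l (Pi.single m 1) j) * coeff m (genericChange (f i))
  have hA : ∀ g, evalGL g A.det = (Matrix.of fun i => l (coeffVec T (coordChange g (f i)))).det := by
    intro g
    rw [RingHom.map_det]
    congr 1
    ext i j
    simp only [A, RingHom.mapMatrix_apply, Matrix.map_apply, Matrix.of_apply, map_sum, map_mul,
      eval_coeff_genericChange, eval_C]
    rw [LinearMap.pi_apply_eq_sum_univ l, Finset.sum_apply]
    refine Finset.sum_congr rfl fun m _ => ?_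
    rw [Pi.smul_apply, smul_eq_mul, mul_comm, coeffVec_apply]
    have : (fun j => if m = j then (1 : K) else 0) = Pi.single m 1 := by
      ext k
      simp [Pi.single_apply, eq_comm]
    rw [this]
  refine ⟨A.det, fun h => ?_, fun g hg h => (hmax h).trans ?_⟩
  · have := hA h₀
    rw [h, map_zero] at this
    erw [hl] at this
    simp at this
  · rw [hA] at hg
    simpa using card_le_coeffRank (J := I.map (coordChange g))
      (fun i => Ideal.mem_map_of_mem _ (hfI i)) (linearIndependent_of_det_ne_zero l hg)

/-! ### Leading exponents for a term order refining the weight -/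

/-- The key of an exponent for the term order that compares weights first and breaks ties
lexicographically. -/
noncomputable def termKey (ω : Fin n → ℝ) (m : Fin n →₀ ℕ) : ℝ ×ₗ Lex (Fin n →₀ ℕ) :=
  toLex (Finsupp.weight ω m, toLex m)

theorem termKey_le_iff {ω : Fin n → ℝ} {a b : Fin n →₀ ℕ} : termKey ω a ≤ termKey ω b ↔
    Finsupp.weight ω a < Finsupp.weight ω b ∨
      Finsupp.weight ω a = Finsupp.weight ω b ∧ toLex a ≤ toLex b :=
  Prod.Lex.toLex_le_toLex

theorem termKey_injective (ω : Fin n → ℝ) : Function.Injective (termKey ω) := by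
  intro a b h
  exact toLex.injective (Prod.ext_iff.1 (toLex.injective h)).2

theorem weight_le_of_termKey_le {ω : Fin n → ℝ} {a b : Fin n →₀ ℕ}
    (h : termKey ω a ≤ termKey ω b) : Finsupp.weight ω a ≤ Finsupp.weight ω b := by
  rcases termKey_le_iff.1 h with h | h
  exacts [h.le, h.1.le]

theorem termKey_add_le {ω : Fin n → ℝ} {a b : Fin n →₀ ℕ} (c : Fin n →₀ ℕ)
    (h : termKey ω a ≤ termKey ω b) : termKey ω (a + c) ≤ termKey ω (b + c) := by
  rw [termKey_le_iff] at h ⊢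
  rw [map_add, map_add, toLex_add, toLex_add]
  rcases h with h | h
  · exact Or.inl (by linarith)
  · exact Or.inr ⟨by rw [h.1], by gcongr; exact h.2⟩

/-- The exponents of the leading terms of the homogeneous elements of `J`. -/
def leadingExponents (ω : Fin n → ℝ) (J : Ideal (MvPolynomial (Fin n) K)) : Set (Fin n →₀ ℕ) :=
  {m | ∃ f ∈ J, f.IsHomogeneous m.degree ∧ coeff m f ≠ 0 ∧
    ∀ m' ∈ f.support, termKey ω m' ≤ termKey ω m}

theorem add_mem_leadingExponents {ω : Fin n → ℝ} {J : Ideal (MvPolynomial (Fin n) K)}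
    {m : Fin n →₀ ℕ} (hm : m ∈ leadingExponents ω J) (c : Fin n →₀ ℕ) :
    m + c ∈ leadingExponents ω J := by
  obtain ⟨f, hf, hd, hc, hle⟩ := hm
  refine ⟨f * monomial c 1, J.mul_mem_right _ hf, ?_, ?_, ?_⟩
  · rw [map_add]
    exact hd.mul (isHomogeneous_monomial _ rfl)
  · rwa [coeff_mul_monomial, mul_one]
  · intro m' hm'
    obtain ⟨p, hp, q, hq, rfl⟩ := Finset.mem_add.1 (support_mul _ _ hm')
    rw [Finset.mem_singleton.1 (support_monomial_subset hq)]
    exact termKey_add_le c (hle p hp)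

/-- A final segment, for the term order, of the exponents of degree `d`. -/
structure IsFinalSegment (ω : Fin n → ℝ) (d : ℕ) (T : Finset (Fin n →₀ ℕ)) : Prop where
  degree_eq : ∀ m ∈ T, m.degree = d
  mem_of_le : ∀ m ∈ T, ∀ m' : Fin n →₀ ℕ, m'.degree = d → termKey ω m ≤ termKey ω m' → m' ∈ T

open Classical in
-- Echelon form. A coefficient vector vanishing at the leading exponents in `T` is zero: its largest
-- exponent in `T` would be leading for the degree `d` component, because `T` is closed upwards.
-- Conversely, elements with distinct leading exponents are triangular, hence independent.
theorem coeffRank_eq_card {ω : Fin n → ℝ} {d : ℕ} {T : Finset (Fin n →₀ ℕ)}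
    (hT : IsFinalSegment ω d T) {J : Ideal (MvPolynomial (Fin n) K)} (hJ : ComponentClosed J) :
    coeffRank J T = (T.filter (· ∈ leadingExponents ω J)).card := by
  set S := T.filter (· ∈ leadingExponents ω J) with hS
  apply le_antisymm
  · let r : (T → K) →ₗ[K] (S → K) :=
      LinearMap.funLeft K K fun m : S => (⟨m, (Finset.mem_filter.1 m.2).1⟩ : T)
    have hinj : Function.Injective (r.domRestrict ((J.restrictScalars K).map (coeffVec T))) := by
      rw [← LinearMap.ker_eq_bot, LinearMap.ker_eq_bot']
      rintro ⟨_, f, hf, rfl⟩ h0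
      have h0' : ∀ m ∈ S, coeff m f = 0 := fun m hm => congr_fun h0 ⟨m, hm⟩
      rw [Subtype.ext_iff]
      change coeffVec T f = 0
      by_contra hne
      obtain ⟨m₀, hm₀⟩ := Function.ne_iff.1 hne
      obtain ⟨m, hm, hmax⟩ := Finset.exists_max_image (T.filter fun m => coeff m f ≠ 0) (termKey ω)
        ⟨m₀, Finset.mem_filter.2 ⟨m₀.2, hm₀⟩⟩
      obtain ⟨hmT, hmf⟩ := Finset.mem_filter.1 hm
      refine hmf (h0' m (Finset.mem_filter.2 ⟨hmT, homogeneousComponent d f, hJ f hf d, ?_, ?_, ?_⟩))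
      · rw [hT.degree_eq m hmT]
        exact homogeneousComponent_isHomogeneous d f
      · rwa [coeff_homogeneousComponent, if_pos (hT.degree_eq m hmT)]
      · intro m' hm'
        rw [mem_support_iff, coeff_homogeneousComponent] at hm'
        split_ifs at hm' with hd
        · by_contra! hlt
          exact hlt.not_ge (hmax m' (Finset.mem_filter.2 ⟨hT.mem_of_le m hmT m' hd hlt.le, hm'⟩))
        · exact absurd rfl hm'
    have := LinearMap.finrank_le_finrank_of_injective hinj
    simpa [coeffRank] using this
  · have hmem : ∀ m : S, (m : Fin n →₀ ℕ) ∈ leadingExponents ω J :=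
      fun m => (Finset.mem_filter.1 m.2).2
    choose f hf hd hc hle using hmem
    have hind : LinearIndependent K fun m => coeffVec T (f m) := by
      rw [Fintype.linearIndependent_iff]
      intro c h0
      by_contra! hne
      obtain ⟨m₀, hm₀⟩ := hne
      obtain ⟨m, hm, hmax⟩ := Finset.exists_max_image (Finset.univ.filter fun m => c m ≠ 0)
        (fun m : S => termKey ω m) ⟨m₀, Finset.mem_filter.2 ⟨Finset.mem_univ _, hm₀⟩⟩
      have h1 := congr_fun h0 ⟨m, (Finset.mem_filter.1 m.2).1⟩
      rw [Finset.sum_apply, Finset.sum_eq_single m] at h1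
      · exact mul_ne_zero (Finset.mem_filter.1 hm).2 (hc m) h1
      · intro m' _ hne
        rw [Pi.smul_apply, coeffVec_apply, smul_eq_mul]
        by_contra h2
        have h3 := hle m' m (mem_support_iff.2 (right_ne_zero_of_mul h2))
        have h4 := hmax m' (Finset.mem_filter.2 ⟨Finset.mem_univ _, left_ne_zero_of_mul h2⟩)
        exact hne (Subtype.ext (termKey_injective ω (le_antisymm h4 h3)))
      · simp
    simpa using card_le_coeffRank hf hind

theorem coeffRank_le_of_leadingExponents_subset {ω : Fin n → ℝ} {d : ℕ}
    {T : Finset (Fin n →₀ ℕ)} (hT : IsFinalSegment ω d T) {J J' : Ideal (MvPolynomial (Fin n) K)}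
    (hJ : ComponentClosed J) (hJ' : ComponentClosed J')
    (h : ∀ m ∈ leadingExponents ω J, m.degree = d → m ∈ leadingExponents ω J') :
    coeffRank J T ≤ coeffRank J' T := by
  classical
  rw [coeffRank_eq_card hT hJ, coeffRank_eq_card hT hJ']
  refine Finset.card_le_card fun m hm => ?_
  rw [Finset.mem_filter] at hm ⊢
  exact ⟨hm.1, h m hm.2 (hT.degree_eq m hm.1)⟩

/-! ### Leading exponents of generic translates, in one degree and in all degrees. -/

/-- The exponents of degree `d`. -/
noncomputable def degreeExponents (n d : ℕ) : Finset (Fin n →₀ ℕ) :=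
  Finset.univ.finsuppAntidiag d

@[simp]
theorem mem_degreeExponents {d : ℕ} {m : Fin n →₀ ℕ} : m ∈ degreeExponents n d ↔ m.degree = d := by
  simp [degreeExponents, Finset.mem_finsuppAntidiag, Finsupp.degree_eq_sum]

open Classical in
-- The exponents `≥ m` and those `> m` both form final segments, and the two ranks differ by one
-- exactly when `m` is a leading exponent.
theorem mem_leadingExponents_of_coeffRank_eq {ω : Fin n → ℝ} {d : ℕ}
    {J J' : Ideal (MvPolynomial (Fin n) K)} (hJ : ComponentClosed J) (hJ' : ComponentClosed J')
    (h : ∀ T ⊆ degreeExponents n d, coeffRank J T = coeffRank J' T) {m : Fin n →₀ ℕ}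
    (hd : m.degree = d) (hm : m ∈ leadingExponents ω J) : m ∈ leadingExponents ω J' := by
  set T := (degreeExponents n d).filter fun m' => termKey ω m ≤ termKey ω m' with hTdef
  have hmT : m ∈ T := by simp [T, hd]
  have hT : IsFinalSegment ω d T := by
    refine ⟨fun m' h' => by simpa using (Finset.mem_filter.1 h').1, fun a ha b hb hab => ?_⟩
    exact Finset.mem_filter.2 ⟨by simpa using hb, (Finset.mem_filter.1 ha).2.trans hab⟩
  have hT' : IsFinalSegment ω d (T.erase m) := by
    refine ⟨fun m' h' => hT.degree_eq m' (Finset.mem_of_mem_erase h'), fun a ha b hb hab => ?_⟩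
    obtain ⟨hne, haT⟩ := Finset.mem_erase.1 ha
    refine Finset.mem_erase.2 ⟨?_, hT.mem_of_le a haT b hb hab⟩
    rintro rfl
    exact hne (termKey_injective ω (le_antisymm hab (Finset.mem_filter.1 haT).2))
  have h1 := h T (Finset.filter_subset _ _)
  have h2 := h (T.erase m) ((Finset.erase_subset _ _).trans (Finset.filter_subset _ _))
  rw [coeffRank_eq_card hT hJ, coeffRank_eq_card hT hJ'] at h1
  rw [coeffRank_eq_card hT' hJ, coeffRank_eq_card hT' hJ'] at h2
  by_contra hm'
  have e : (T.erase m).filter (· ∈ leadingExponents ω J) =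
      (T.filter (· ∈ leadingExponents ω J)).erase m := by
    ext; simp [and_assoc]
  have e' : (T.erase m).filter (· ∈ leadingExponents ω J') =
      T.filter (· ∈ leadingExponents ω J') := by
    ext a
    simp only [Finset.mem_filter, Finset.mem_erase]
    exact ⟨fun h => ⟨h.1.2, h.2⟩, fun h => ⟨⟨fun hh => hm' (hh ▸ h.2), h.1⟩, h.2⟩⟩
  have hmem : m ∈ T.filter (· ∈ leadingExponents ω J) := Finset.mem_filter.2 ⟨hmT, hm⟩
  have hpos := Finset.card_pos.2 ⟨m, hmem⟩
  rw [e, e', Finset.card_erase_of_mem hmem] at h2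
  omega

/-- Dickson's lemma: the minimal elements form an antichain in a well-quasi-order. No closure
property of `p` is needed. -/
theorem exists_finset_generating (p : (Fin n →₀ ℕ) → Prop) :
    ∃ M : Finset (Fin n →₀ ℕ), (∀ m ∈ M, p m) ∧ ∀ m, p m → ∃ m₀ ∈ M, m₀ ≤ m := by
  have hfin : {m | Minimal p m}.Finite :=
    (setOfPred_minimal_antichain _).finite_of_partiallyWellOrderedOn
      (Set.isPWO_of_wellQuasiOrderedLE _)
  refine ⟨hfin.toFinset, fun m hm => (hfin.mem_toFinset.1 hm).prop, fun m hm => ?_⟩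
  obtain ⟨m₀, hle, hmin⟩ := exists_minimal_le_of_wellFoundedLT p m hm
  exact ⟨m₀, hfin.mem_toFinset.2 hmin, hle⟩

theorem exists_isGenericAt_degree (I : Ideal (MvPolynomial (Fin n) K)) (d : ℕ) :
    ∃ P : MvPolynomial (Fin n × Fin n) K, P ≠ 0 ∧ ∀ g, evalGL g P ≠ 0 →
      ∀ T ⊆ degreeExponents n d, IsGenericAt I T g := by
  choose P hP0 hP using exists_isGenericAt_of_evalGL_ne_zero I
  refine ⟨∏ T ∈ (degreeExponents n d).powerset, P T, Finset.prod_ne_zero_iff.2 fun T _ => hP0 T,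
    fun g h T hT => ?_⟩
  rw [map_prod, Finset.prod_ne_zero_iff] at h
  exact hP T g (h T (Finset.mem_powerset.2 hT))

theorem mem_leadingExponents_of_isGenericAt {I : Ideal (MvPolynomial (Fin n) K)}
    (hI : ComponentClosed I) {ω : Fin n → ℝ} {d : ℕ} {g g' : GL (Fin n) K}
    (hg : ∀ T ⊆ degreeExponents n d, IsGenericAt I T g)
    (hg' : ∀ T ⊆ degreeExponents n d, IsGenericAt I T g') {m : Fin n →₀ ℕ} (hd : m.degree = d)
    (hm : m ∈ leadingExponents ω (I.map (coordChange g))) :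
    m ∈ leadingExponents ω (I.map (coordChange g')) :=
  mem_leadingExponents_of_coeffRank_eq (hI.map_coordChange g) (hI.map_coordChange g')
    (fun T hT => le_antisymm (hg' T hT g) (hg T hT g')) hd hm

theorem isGenericAt_of_leadingExponents_subset {I : Ideal (MvPolynomial (Fin n) K)}
    (hI : ComponentClosed I) {ω : Fin n → ℝ} {d : ℕ} {g g' : GL (Fin n) K}
    {T : Finset (Fin n →₀ ℕ)} (hT : IsFinalSegment ω d T) (hg : IsGenericAt I T g)
    (h : ∀ m ∈ leadingExponents ω (I.map (coordChange g)), m.degree = d →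
      m ∈ leadingExponents ω (I.map (coordChange g'))) : IsGenericAt I T g' :=
  fun k => (hg k).trans (coeffRank_le_of_leadingExponents_subset hT (hI.map_coordChange g)
    (hI.map_coordChange g') h)

/-- The coefficient ranks of `gI` on all final segments are simultaneously as large as possible on
a non-empty open set of coordinate changes. -/
theorem exists_isGenericAt_isFinalSegment [Infinite K] {I : Ideal (MvPolynomial (Fin n) K)}
    (hI : ComponentClosed I) (ω : Fin n → ℝ) :
    ∃ P : MvPolynomial (Fin n × Fin n) K, P ≠ 0 ∧ ∀ g, evalGL g P ≠ 0 →
      ∀ d T, IsFinalSegment ω d T → IsGenericAt I T g := by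
  choose Q hQ0 hQ using exists_isGenericAt_degree I
  have hγ : ∀ d, ∃ g : GL (Fin n) K, ∀ T ⊆ degreeExponents n d, IsGenericAt I T g := fun d =>
    (exists_evalGL_ne_zero (hQ0 d)).imp fun g hg => hQ d g hg
  choose γ hγ using hγ
  obtain ⟨M₀, hM₀, hgen⟩ := exists_finset_generating
    fun m => m ∈ leadingExponents ω (I.map (coordChange (γ m.degree)))
  -- Genericity is imposed only in the finitely many degrees of `M₀`. In any other degree,
  -- multiplying by monomials gives `gI` all the leading exponents of the generic translate, hence
  -- the maximal ranks.
  refine ⟨∏ m ∈ M₀, Q m.degree, Finset.prod_ne_zero_iff.2 fun m _ => hQ0 _, ?_⟩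
  intro g hg d T hT
  have hg' : ∀ m ∈ M₀, ∀ T ⊆ degreeExponents n m.degree, IsGenericAt I T g := by
    rw [map_prod, Finset.prod_ne_zero_iff] at hg
    exact fun m hm => hQ _ g (hg m hm)
  refine isGenericAt_of_leadingExponents_subset hI hT
    (hγ d T fun m hm => mem_degreeExponents.2 (hT.degree_eq m hm)) fun m hm hd => ?_
  subst hd
  obtain ⟨m₀, hm₀, hle⟩ := hgen m hm
  have h1 := mem_leadingExponents_of_isGenericAt hI (hγ m₀.degree) (hg' m₀ hm₀) rfl
    (hM₀ m₀ hm₀)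
  have h2 := add_mem_leadingExponents h1 (m - m₀)
  rwa [add_tsub_cancel_of_le hle] at h2

/-! ### Components of top weight -/

/-- The bounds `v` and `w` need not be attained: a product term of weight `v + w` can only come from
terms of weights exactly `v` and `w`. -/
theorem weightedHomogeneousComponent_mul_of_weight_le {ω : Fin n → ℝ}
    {f g : MvPolynomial (Fin n) K} {v w : ℝ} (hf : ∀ a ∈ f.support, Finsupp.weight ω a ≤ v)
    (hg : ∀ a ∈ g.support, Finsupp.weight ω a ≤ w) :
    weightedHomogeneousComponent ω (v + w) (f * g) =
      weightedHomogeneousComponent ω v f * weightedHomogeneousComponent ω w g := by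
  classical
  ext c
  rw [coeff_weightedHomogeneousComponent, coeff_mul, coeff_mul]
  simp only [coeff_weightedHomogeneousComponent]
  have hsum : ∀ (p : Prop) [Decidable p] (s : Finset ((Fin n →₀ ℕ) × (Fin n →₀ ℕ)))
      (F : (Fin n →₀ ℕ) × (Fin n →₀ ℕ) → K),
      (if p then ∑ x ∈ s, F x else 0) = ∑ x ∈ s, if p then F x else 0 := by
    intro p _ s F
    split_ifs <;> simp
  rw [hsum]
  refine Finset.sum_congr rfl fun x hx => ?_
  rw [Finset.HasAntidiagonal.mem_antidiagonal] at hx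
  subst hx
  rw [map_add]
  by_cases h1 : coeff x.1 f = 0
  · simp [h1]
  by_cases h2 : coeff x.2 g = 0
  · simp [h2]
  have h3 := hf _ (mem_support_iff.2 h1)
  have h4 := hg _ (mem_support_iff.2 h2)
  by_cases h5 : Finsupp.weight ω x.1 = v
  · by_cases h6 : Finsupp.weight ω x.2 = w
    · simp [h5, h6]
    · simp [h5, h6]
  · have : Finsupp.weight ω x.1 + Finsupp.weight ω x.2 ≠ v + w := by
      have := lt_of_le_of_ne h3 h5
      linarith
    simp [h5, this]

theorem weight_le_of_mem_support_mul {ω : Fin n → ℝ}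
    {f g : MvPolynomial (Fin n) K} {v w : ℝ} (hf : ∀ a ∈ f.support, Finsupp.weight ω a ≤ v)
    (hg : ∀ a ∈ g.support, Finsupp.weight ω a ≤ w) :
    ∀ a ∈ (f * g).support, Finsupp.weight ω a ≤ v + w := by
  classical
  intro a ha
  obtain ⟨p, hp, q, hq, rfl⟩ := Finset.mem_add.1 (support_mul _ _ ha)
  rw [map_add]
  exact add_le_add (hf p hp) (hg q hq)

theorem weightedHomogeneousComponent_prod_of_weight_le {ω : Fin n → ℝ} {ι : Type*} (s : Finset ι)
    {f : ι → MvPolynomial (Fin n) K} {w : ι → ℝ}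
    (hf : ∀ i, ∀ a ∈ (f i).support, Finsupp.weight ω a ≤ w i) :
    (∀ a ∈ (∏ i ∈ s, f i).support, Finsupp.weight ω a ≤ ∑ i ∈ s, w i) ∧
    weightedHomogeneousComponent ω (∑ i ∈ s, w i) (∏ i ∈ s, f i) =
      ∏ i ∈ s, weightedHomogeneousComponent ω (w i) (f i) := by
  classical
  induction s using Finset.induction_on with
  | empty =>
    constructor
    · intro a ha
      rw [Finset.prod_empty, support_one, Finset.mem_singleton] at ha
      simp [ha]
    · simpa using (isWeightedHomogeneous_one K ω).weightedHomogeneousComponent_same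
  | insert i s hi ih =>
    rw [Finset.prod_insert hi, Finset.sum_insert hi, Finset.prod_insert hi]
    exact ⟨weight_le_of_mem_support_mul (hf i) ih.1,
      by rw [weightedHomogeneousComponent_mul_of_weight_le (hf i) ih.1, ih.2]⟩

theorem weightedHomogeneousComponent_det_of_weight_le {ω : Fin n → ℝ} {k : ℕ}
    {A : Matrix (Fin k) (Fin k) (MvPolynomial (Fin n) K)} {w : Fin k → ℝ}
    (hA : ∀ i j, ∀ a ∈ (A i j).support, Finsupp.weight ω a ≤ w i) :
    weightedHomogeneousComponent ω (∑ i, w i) A.det =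
      (Matrix.of fun i j => weightedHomogeneousComponent ω (w i) (A i j)).det := by
  rw [det_apply, det_apply, map_sum]
  refine Finset.sum_congr rfl fun σ _ => ?_
  -- The expansion runs over the entries `A (σ i) i`, so the row bounds are reindexed by `σ`.
  rw [← Equiv.sum_comp σ w, Units.smul_def, Units.smul_def, map_zsmul,
    (weightedHomogeneousComponent_prod_of_weight_le Finset.univ fun i => hA (σ i) i).2]
  rfl

/-! ### Initial forms -/

theorem exists_max_weight {f : MvPolynomial (Fin n) K} (hf : f ≠ 0) (ω : Fin n → ℝ) :
    ∃ w, (∀ a ∈ f.support, Finsupp.weight ω a ≤ w) ∧ ∃ a ∈ f.support, Finsupp.weight ω a = w := by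
  obtain ⟨a, ha, hmax⟩ := Finset.exists_max_image f.support (Finsupp.weight ω)
    (support_nonempty.2 hf)
  exact ⟨_, hmax, a, ha, rfl⟩

theorem initialForm_eq {f : MvPolynomial (Fin n) K} {ω : Fin n → ℝ} {w : ℝ}
    (hle : ∀ a ∈ f.support, Finsupp.weight ω a ≤ w)
    (hw : ∃ a ∈ f.support, Finsupp.weight ω a = w) :
    initialForm ω f = weightedHomogeneousComponent ω w f := by
  classical
  obtain ⟨a₀, ha₀, rfl⟩ := hw
  rw [initialForm, weightedHomogeneousComponent_apply]
  refine Finset.sum_congr ?_ fun _ _ => rfl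
  ext a
  simp only [Finset.mem_filter]
  exact and_congr_right fun ha => ⟨fun h => le_antisymm (hle a ha) (h a₀ ha₀), fun h c hc =>
    (hle c hc).trans h.ge⟩

theorem initialForm_zero (ω : Fin n → ℝ) : initialForm ω (0 : MvPolynomial (Fin n) K) = 0 := by
  simp [initialForm]

theorem initialForm_monomial_mul (ω : Fin n → ℝ) (c : Fin n →₀ ℕ) (f : MvPolynomial (Fin n) K) :
    initialForm ω (monomial c 1 * f) = monomial c 1 * initialForm ω f := by
  classical
  rcases eq_or_ne f 0 with rfl | hf
  · rw [mul_zero, initialForm_zero, mul_zero]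
  obtain ⟨w, hle, a, ha, haw⟩ := exists_max_weight hf ω
  have hc : ∀ a ∈ (monomial c (1 : K)).support, Finsupp.weight ω a ≤ Finsupp.weight ω c :=
    fun a ha => by rw [Finset.mem_singleton.1 (support_monomial_subset ha)]
  rw [initialForm_eq hle ⟨a, ha, haw⟩, initialForm_eq (weight_le_of_mem_support_mul hc hle)
    ⟨c + a, by rwa [mem_support_iff, coeff_monomial_mul, one_mul, ← mem_support_iff],
      by rw [map_add, haw]⟩, weightedHomogeneousComponent_mul_of_weight_le hc hle,
    (isWeightedHomogeneous_monomial ω c 1 rfl).weightedHomogeneousComponent_same]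

/-- The initial forms of the homogeneous elements of `J`. -/
def initialForms (ω : Fin n → ℝ) (J : Ideal (MvPolynomial (Fin n) K)) :
    Set (MvPolynomial (Fin n) K) :=
  {f | ∃ d, ∃ F ∈ J, F.IsHomogeneous d ∧ initialForm ω F = f}

/-- The top-weight part of `F` is the sum of the parts of that weight of its homogeneous components,
and each non-zero one is the initial form of its component. -/
theorem initialForm_mem_span_initialForms {ω : Fin n → ℝ} {J : Ideal (MvPolynomial (Fin n) K)}
    (hJ : ComponentClosed J) {F : MvPolynomial (Fin n) K} (hF : F ∈ J) :
    initialForm ω F ∈ Submodule.span K (initialForms ω J) := by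
  classical
  rcases eq_or_ne F 0 with rfl | hF0
  · rw [initialForm_zero]
    exact zero_mem _
  obtain ⟨w, hle, hw⟩ := exists_max_weight hF0 ω
  have hsum : weightedHomogeneousComponent ω w F = ∑ d ∈ Finset.range (F.totalDegree + 1),
      weightedHomogeneousComponent ω w (homogeneousComponent d F) := by
    rw [← map_sum, sum_homogeneousComponent]
  rw [initialForm_eq hle hw, hsum]
  refine Submodule.sum_mem _ fun d _ => ?_
  rcases eq_or_ne (weightedHomogeneousComponent ω w (homogeneousComponent d F)) 0 with h0 | h0
  · rw [h0]
    exact zero_mem _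
  refine Submodule.subset_span ⟨d, homogeneousComponent d F, hJ F hF d,
    homogeneousComponent_isHomogeneous d F, initialForm_eq ?_ ?_⟩
  · intro a ha
    rw [mem_support_iff, coeff_homogeneousComponent] at ha
    exact hle a (mem_support_iff.2 fun h => ha (by simp [h]))
  · obtain ⟨a, ha⟩ := support_nonempty.2 h0
    rw [mem_support_iff, coeff_weightedHomogeneousComponent] at ha
    split_ifs at ha with h1
    · exact ⟨a, mem_support_iff.2 ha, h1⟩
    · exact absurd rfl ha

/-- Monomial multiples of initial forms are again initial forms, so the linear span is already an
ideal. -/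
theorem restrictScalars_initialIdeal {ω : Fin n → ℝ} {J : Ideal (MvPolynomial (Fin n) K)}
    (hJ : ComponentClosed J) :
    (initialIdeal ω J).restrictScalars K = Submodule.span K (initialForms ω J) := by
  apply le_antisymm
  · have hmon : ∀ (c : Fin n →₀ ℕ) (r : K), ∀ f ∈ Submodule.span K (initialForms ω J),
        monomial c r * f ∈ Submodule.span K (initialForms ω J) := by
      intro c r f hf
      induction hf using Submodule.span_induction with
      | mem f hf =>
        obtain ⟨d, F, hF, -, rfl⟩ := hf
        have : monomial c r * initialForm ω F = r • initialForm ω (monomial c 1 * F) := by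
          rw [initialForm_monomial_mul, ← smul_mul_assoc, smul_monomial, smul_eq_mul, mul_one]
        rw [this]
        exact Submodule.smul_mem _ _ (initialForm_mem_span_initialForms hJ (J.mul_mem_left _ hF))
      | zero => simp
      | add f g _ _ hf hg => rw [mul_add]; exact add_mem hf hg
      | smul s f _ hf => rw [mul_smul_comm]; exact Submodule.smul_mem _ _ hf
    intro f hf
    change f ∈ Ideal.span _ at hf
    induction hf using Submodule.span_induction with
    | mem f hf =>
      obtain ⟨F, hF, rfl⟩ := hf
      exact initialForm_mem_span_initialForms hJ hF
    | zero => exact zero_mem _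
    | add f g _ _ hf hg => exact add_mem hf hg
    | smul p f _ hf =>
      rw [smul_eq_mul, p.as_sum, Finset.sum_mul]
      exact Submodule.sum_mem _ fun c _ => hmon c _ f hf
  · rw [Submodule.span_le]
    rintro _ ⟨d, F, hF, -, rfl⟩
    exact Ideal.subset_span ⟨F, hF, rfl⟩

/-! ### Degenerating along the torus -/

/-- The invertible diagonal matrix with the given entries. -/
noncomputable def torus (t : Fin n → K) (ht : ∀ i, t i ≠ 0) : GL (Fin n) K :=
  Matrix.GeneralLinearGroup.mkOfDetNeZero (Matrix.diagonal t)
    (by rw [det_diagonal]; exact Finset.prod_ne_zero_iff.2 fun i _ => ht i)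

theorem coordChange_torus_monomial (t : Fin n → K) (ht : ∀ i, t i ≠ 0) (a : Fin n →₀ ℕ) (c : K) :
    coordChange (torus t ht) (monomial a c) = (a.prod fun i k => t i ^ k) • monomial a c := by
  have hX : ∀ j, coordChange (torus t ht) (X j) = C (t j) * X j := by
    intro j
    rw [coordChange_X, Finset.sum_eq_single j]
    · simp [torus, Matrix.GeneralLinearGroup.mkOfDetNeZero]
    · intro i _ hi
      simp [torus, Matrix.GeneralLinearGroup.mkOfDetNeZero, Matrix.diagonal_apply_ne _ hi]
    · simp
  rw [monomial_eq, map_mul, algHom_C, map_finsuppProd, smul_eq_C_mul, map_finsuppProd,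
    algebraMap_eq]
  simp only [map_pow, hX, mul_pow, Finsupp.prod_mul]
  ring

/-- The polynomial whose value at `t` is the value of the linear functional `l` on the image of `f`
under the torus element `t`. -/
noncomputable def torusPoly (l : MvPolynomial (Fin n) K →ₗ[K] K) (f : MvPolynomial (Fin n) K) :
    MvPolynomial (Fin n) K :=
  ∑ a ∈ f.support, monomial a (l (monomial a (coeff a f)))

theorem coeff_torusPoly (l : MvPolynomial (Fin n) K →ₗ[K] K) (f : MvPolynomial (Fin n) K)
    (a : Fin n →₀ ℕ) : coeff a (torusPoly l f) = l (monomial a (coeff a f)) := by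
  classical
  rw [torusPoly, coeff_sum]
  simp only [coeff_monomial]
  rw [Finset.sum_ite_eq']
  split_ifs with h
  · rfl
  · rw [notMem_support_iff.1 h, monomial_zero, map_zero]

theorem support_torusPoly_subset (l : MvPolynomial (Fin n) K →ₗ[K] K)
    (f : MvPolynomial (Fin n) K) : (torusPoly l f).support ⊆ f.support := by
  intro a ha
  rw [mem_support_iff, coeff_torusPoly] at ha
  exact mem_support_iff.2 fun h => ha (by simp [h])

theorem weightedHomogeneousComponent_torusPoly (l : MvPolynomial (Fin n) K →ₗ[K] K)
    (f : MvPolynomial (Fin n) K) (ω : Fin n → ℝ) (w : ℝ) :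
    weightedHomogeneousComponent ω w (torusPoly l f) =
      torusPoly l (weightedHomogeneousComponent ω w f) := by
  classical
  ext a
  simp only [coeff_weightedHomogeneousComponent, coeff_torusPoly]
  split_ifs <;> simp

theorem eval_torusPoly (l : MvPolynomial (Fin n) K →ₗ[K] K) (f : MvPolynomial (Fin n) K)
    (t : Fin n → K) (ht : ∀ i, t i ≠ 0) :
    eval t (torusPoly l f) = l (coordChange (torus t ht) f) := by
  conv_rhs => rw [f.as_sum, map_sum, map_sum]
  rw [torusPoly, map_sum]
  refine Finset.sum_congr rfl fun a _ => ?_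
  rw [coordChange_torus_monomial, map_smul, eval_monomial, smul_eq_mul, mul_comm]

theorem torus_one : torus (1 : Fin n → K) (fun _ => one_ne_zero) = 1 := by
  ext i j
  simp [torus, Matrix.GeneralLinearGroup.mkOfDetNeZero, Matrix.one_apply]

/-- Semicontinuity along the torus. A minor for the translates `b t J` is a polynomial in `t`, and
its top-weight part is the minor built from initial forms. That part is non-zero, so the polynomial
is too, and some `t` keeps the rank. -/
theorem exists_coeffRank_initialIdeal_le [Infinite K] {J : Ideal (MvPolynomial (Fin n) K)}
    (hJ : ComponentClosed J) (ω : Fin n → ℝ) (b : GL (Fin n) K) (T : Finset (Fin n →₀ ℕ)) :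
    ∃ h : GL (Fin n) K, coeffRank ((initialIdeal ω J).map (coordChange b)) T ≤
      coeffRank (J.map (coordChange h)) T := by
  obtain ⟨f, hf, hind⟩ := exists_linearIndependent_coeffVec (restrictScalars_initialIdeal hJ)
    (coordChange b).toLinearMap (restrictScalars_map_coordChange (initialIdeal ω J) b) T
  generalize coeffRank ((initialIdeal ω J).map (coordChange b)) T = k at f hf hind ⊢
  choose d F hFJ hFd hFf using hf
  have hF0 : ∀ i, F i ≠ 0 := by
    intro i h0
    refine hind.ne_zero i ?_
    rw [← hFf, h0, initialForm_zero, map_zero, map_zero]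
  choose w hle hw using fun i => exists_max_weight (hF0 i) ω
  obtain ⟨l, hl⟩ := exists_dual_family hind
  let l' : Fin k → MvPolynomial (Fin n) K →ₗ[K] K := fun j =>
    LinearMap.proj j ∘ₗ l ∘ₗ coeffVec T ∘ₗ (coordChange b).toLinearMap
  have hl' : ∀ j p, l' j p = l (coeffVec T (coordChange b p)) j := fun _ _ => rfl
  clear_value l'
  have hQ : (Matrix.of fun i j => torusPoly (l' j) (F i)).det ≠ 0 := by
    intro h0
    have h1 := weightedHomogeneousComponent_det_of_weight_le (ω := ω) (w := w)
      (A := Matrix.of fun i j => torusPoly (l' j) (F i))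
      (fun i j a ha => hle i a (support_torusPoly_subset _ _ ha))
    rw [h0, map_zero] at h1
    -- At `t = 1` the top-weight part is the determinant of the dual-basis matrix, which is 1.
    have h2 := congrArg (eval (1 : Fin n → K)) h1
    rw [map_zero, RingHom.map_det] at h2
    have h3 : (eval (1 : Fin n → K)).mapMatrix (Matrix.of fun i j =>
        weightedHomogeneousComponent ω (w i) ((Matrix.of fun i j => torusPoly (l' j) (F i)) i j)) =
        1 := by
      rw [← hl]
      ext i j
      rw [RingHom.mapMatrix_apply, Matrix.map_apply, Matrix.of_apply, Matrix.of_apply,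
        Matrix.of_apply, weightedHomogeneousComponent_torusPoly, ← initialForm_eq (hle i) (hw i),
        hFf, eval_torusPoly _ _ (1 : Fin n → K) (fun _ => one_ne_zero), torus_one, coordChange_one, hl']
      rfl
    rw [h3, det_one] at h2
    exact zero_ne_one h2
  have hX : (∏ i, X i : MvPolynomial (Fin n) K) ≠ 0 :=
    Finset.prod_ne_zero_iff.2 fun i _ => X_ne_zero i
  -- The factor `∏ X i` forces `t` to have non-zero coordinates.
  obtain ⟨t, ht⟩ : ∃ t : Fin n → K, eval t ((Matrix.of fun i j => torusPoly (l' j) (F i)).det *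
      ∏ i, X i) ≠ 0 := by
    by_contra! h
    exact mul_ne_zero hQ hX (MvPolynomial.funext fun t => by rw [h, map_zero])
  rw [map_mul, map_prod] at ht
  have ht0 : ∀ i, t i ≠ 0 := fun i => by
    simpa using Finset.prod_ne_zero_iff.1 (right_ne_zero_of_mul ht) i (Finset.mem_univ i)
  refine ⟨b * torus t ht0, ?_⟩
  have hdet := left_ne_zero_of_mul ht
  rw [RingHom.map_det] at hdet
  have h4 : (eval t).mapMatrix (Matrix.of fun i j => torusPoly (l' j) (F i)) =
      Matrix.of fun i => l (coeffVec T (coordChange (b * torus t ht0) (F i))) := by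
    ext i j
    rw [RingHom.mapMatrix_apply, Matrix.map_apply, Matrix.of_apply, eval_torusPoly _ _ _ ht0, hl',
      coordChange_mul]
    rfl
  rw [h4] at hdet
  simpa using card_le_coeffRank (J := J.map (coordChange (b * torus t ht0)))
    (fun i => Ideal.mem_map_of_mem _ (hFJ i)) (linearIndependent_of_det_ne_zero l hdet)

/-! ### Stability of generic initial ideals -/

theorem mem_support_of_mem_support_component {ω : Fin n → ℝ} {w : ℝ}
    {F : MvPolynomial (Fin n) K} {a : Fin n →₀ ℕ}
    (ha : a ∈ (weightedHomogeneousComponent ω w F).support) :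
    a ∈ F.support ∧ Finsupp.weight ω a = w := by
  classical
  rw [mem_support_iff, coeff_weightedHomogeneousComponent] at ha
  split_ifs at ha with h
  · exact ⟨mem_support_iff.2 ha, h⟩
  · exact absurd rfl ha

theorem initialForm_support_subset (ω : Fin n → ℝ) (F : MvPolynomial (Fin n) K) :
    (initialForm ω F).support ⊆ F.support := by
  rcases eq_or_ne F 0 with rfl | hF0
  · rw [initialForm_zero]
  obtain ⟨w, hle, hw⟩ := exists_max_weight hF0 ω
  rw [initialForm_eq hle hw]
  exact fun a ha => (mem_support_of_mem_support_component ha).1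

theorem isHomogeneous_of_support_subset {F G : MvPolynomial (Fin n) K} {d : ℕ}
    (hF : F.IsHomogeneous d) (h : G.support ⊆ F.support) : G.IsHomogeneous d :=
  fun _ ha => hF (mem_support_iff.1 (h (mem_support_iff.2 ha)))

theorem degree_eq_of_mem_support {F : MvPolynomial (Fin n) K} {d : ℕ} (hF : F.IsHomogeneous d)
    {a : Fin n →₀ ℕ} (ha : a ∈ F.support) : a.degree = d := by
  by_contra h
  exact mem_support_iff.1 ha (hF.coeff_eq_zero h)

theorem ComponentClosed.initialIdeal {J : Ideal (MvPolynomial (Fin n) K)}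
    (hJ : ComponentClosed J) (ω : Fin n → ℝ) : ComponentClosed (initialIdeal ω J) := by
  intro f hf d
  have hf' : f ∈ (WeightInitial.initialIdeal ω J).restrictScalars K := hf
  rw [restrictScalars_initialIdeal hJ] at hf'
  clear hf
  induction hf' using Submodule.span_induction with
  | mem f hf' =>
    obtain ⟨d', F, hF, hFd, rfl⟩ := hf'
    rw [homogeneousComponent_of_mem
      (isHomogeneous_of_support_subset hFd (initialForm_support_subset ω F))]
    split_ifs
    · exact Ideal.subset_span ⟨F, hF, rfl⟩
    · exact zero_mem _
  | zero => rw [map_zero]; exact zero_mem _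
  | add f g _ _ hf hg => rw [map_add]; exact add_mem hf hg
  | smul r f _ hf => rw [map_smul]; exact Submodule.smul_of_tower_mem _ r hf

/-- The term order compares weights first, so the leading term of `F` survives in its initial form.
Hence ranks on final segments do not drop from `J` to its initial ideal. -/
theorem leadingExponents_subset_initialIdeal (ω : Fin n → ℝ)
    (J : Ideal (MvPolynomial (Fin n) K)) :
    ∀ m ∈ leadingExponents ω J, m ∈ leadingExponents ω (initialIdeal ω J) := by
  classical
  rintro m ⟨F, hF, hd, hc, hle⟩
  have hm : initialForm ω F = weightedHomogeneousComponent ω (Finsupp.weight ω m) F :=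
    initialForm_eq (fun a ha => weight_le_of_termKey_le (hle a ha)) ⟨m, mem_support_iff.2 hc, rfl⟩
  refine ⟨initialForm ω F, Ideal.subset_span ⟨F, hF, rfl⟩,
    isHomogeneous_of_support_subset hd (initialForm_support_subset ω F), ?_,
    fun m' hm' => hle m' (initialForm_support_subset ω F hm')⟩
  rwa [hm, coeff_weightedHomogeneousComponent, if_pos rfl]

/-! ### Truncation above a given weight. -/

open Classical in
/-- The exponents of degree `d` and weight greater than `w`. -/
noncomputable def exponentsAbove (ω : Fin n → ℝ) (d : ℕ) (w : ℝ) : Finset (Fin n →₀ ℕ) :=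
  (degreeExponents n d).filter fun m => w < Finsupp.weight ω m

theorem mem_exponentsAbove {ω : Fin n → ℝ} {d : ℕ} {w : ℝ} {m : Fin n →₀ ℕ} :
    m ∈ exponentsAbove ω d w ↔ m.degree = d ∧ w < Finsupp.weight ω m := by
  simp [exponentsAbove]

theorem isFinalSegment_exponentsAbove (ω : Fin n → ℝ) (d : ℕ) (w : ℝ) :
    IsFinalSegment ω d (exponentsAbove ω d w) where
  degree_eq _ hm := (mem_exponentsAbove.1 hm).1
  mem_of_le _ hm _ hd hle := mem_exponentsAbove.2
    ⟨hd, (mem_exponentsAbove.1 hm).2.trans_le (weight_le_of_termKey_le hle)⟩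

/-- The polynomial with given coefficients at `T` and no other terms. -/
noncomputable def ofCoeffVec (T : Finset (Fin n →₀ ℕ)) : (T → K) →ₗ[K] MvPolynomial (Fin n) K :=
  ∑ m : T, monomial (m : Fin n →₀ ℕ) ∘ₗ LinearMap.proj m

theorem coeff_ofCoeffVec (T : Finset (Fin n →₀ ℕ)) (v : T → K) (m : T) :
    coeff m (ofCoeffVec T v) = v m := by
  classical
  rw [ofCoeffVec, LinearMap.sum_apply, coeff_sum, Finset.sum_eq_single m]
  · simp
  · intro m' _ hne
    simp [coeff_monomial, Subtype.ext_iff.not.1 hne]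
  · simp

theorem support_ofCoeffVec_subset (T : Finset (Fin n →₀ ℕ)) (v : T → K) :
    (ofCoeffVec T v).support ⊆ T := by
  classical
  intro a ha
  rw [ofCoeffVec, LinearMap.sum_apply] at ha
  obtain ⟨m, -, hm⟩ := Finset.mem_biUnion.1 (support_sum ha)
  rw [Finset.mem_singleton.1 (support_monomial_subset hm)]
  exact m.2

theorem eq_of_coeffVec_eq {T : Finset (Fin n →₀ ℕ)} {f g : MvPolynomial (Fin n) K}
    (hf : f.support ⊆ T) (hg : g.support ⊆ T) (h : coeffVec T f = coeffVec T g) : f = g := by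
  ext a
  by_cases ha : a ∈ T
  · exact congr_fun h ⟨a, ha⟩
  · rw [notMem_support_iff.1 fun h => ha (hf h), notMem_support_iff.1 fun h => ha (hg h)]

theorem ofCoeffVec_coeffVec {T : Finset (Fin n →₀ ℕ)} {f : MvPolynomial (Fin n) K}
    (hf : f.support ⊆ T) : ofCoeffVec T (coeffVec T f) = f :=
  eq_of_coeffVec_eq (support_ofCoeffVec_subset _ _) hf (funext fun m => coeff_ofCoeffVec T _ m)

theorem exists_weight_lt_of_mem_support_coordChange_sub {ω : Fin n → ℝ} {hω : Antitone ω}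
    {b : GL (Fin n) K} (hb : b ∈ weightBorel K ω hω) (f : MvPolynomial (Fin n) K) :
    ∀ m ∈ (coordChange b f - f).support,
      ∃ a ∈ f.support, Finsupp.weight ω a < Finsupp.weight ω m := by
  classical
  intro m hm
  have e : coordChange b f - f = ∑ a ∈ f.support,
      coeff a f • (coordChange b (monomial a 1) - monomial a 1) := by
    conv_lhs => rw [f.as_sum, map_sum, ← Finset.sum_sub_distrib]
    refine Finset.sum_congr rfl fun a _ => ?_
    rw [smul_sub, ← map_smul, smul_monomial, smul_eq_mul, mul_one]
  rw [e] at hm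
  obtain ⟨a, ha, hm⟩ := Finset.mem_biUnion.1 (support_sum hm)
  exact ⟨a, ha, lt_weight_of_mem_support_coordChange_sub hb a m (support_smul hm)⟩

theorem support_coordChange_subset_exponentsAbove {ω : Fin n → ℝ} {hω : Antitone ω}
    {b : GL (Fin n) K} (hb : b ∈ weightBorel K ω hω) {f : MvPolynomial (Fin n) K} {d : ℕ} {w : ℝ}
    (hf : f.support ⊆ exponentsAbove ω d w) :
    (coordChange b f).support ⊆ exponentsAbove ω d w := by
  classical
  intro m hm
  have hfd : f.IsHomogeneous d := by
    intro a ha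
    refine (DFunLike.congr_fun Finsupp.degree_eq_weight_one a).symm.trans ?_
    exact (mem_exponentsAbove.1 (hf (mem_support_iff.2 ha))).1
  refine mem_exponentsAbove.2 ⟨degree_eq_of_mem_support (isHomogeneous_coordChange b hfd) hm, ?_⟩
  rw [← sub_add_cancel (coordChange b f) f] at hm
  rcases Finset.mem_union.1 (support_add hm) with h | h
  · obtain ⟨a, ha, hlt⟩ := exists_weight_lt_of_mem_support_coordChange_sub hb f m h
    exact (mem_exponentsAbove.1 (hf ha)).2.trans hlt
  · exact (mem_exponentsAbove.1 (hf h)).2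

/-- The initial forms of weight greater than `w` of the elements of `J` of degree `d`. -/
def initialFormsAbove (ω : Fin n → ℝ) (J : Ideal (MvPolynomial (Fin n) K)) (d : ℕ) (w : ℝ) :
    Set (MvPolynomial (Fin n) K) :=
  {f | ∃ F ∈ J, F.IsHomogeneous d ∧ initialForm ω F = f ∧ ∃ v, w < v ∧
    (∀ a ∈ F.support, Finsupp.weight ω a ≤ v) ∧ ∃ a ∈ F.support, Finsupp.weight ω a = v}

/-- The initial form of a homogeneous element has a single degree and weight, so truncation either
keeps it whole or kills it. -/
theorem ofCoeffVec_mem_span_initialFormsAbove {ω : Fin n → ℝ}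
    {J : Ideal (MvPolynomial (Fin n) K)} (hJ : ComponentClosed J) (d : ℕ) (w : ℝ)
    {f : MvPolynomial (Fin n) K} (hf : f ∈ initialIdeal ω J) :
    ofCoeffVec (exponentsAbove ω d w) (coeffVec (exponentsAbove ω d w) f) ∈
      Submodule.span K (initialFormsAbove ω J d w) := by
  change f ∈ (initialIdeal ω J).restrictScalars K at hf
  rw [restrictScalars_initialIdeal hJ] at hf
  induction hf using Submodule.span_induction with
  | mem f hf =>
    obtain ⟨d', F, hF, hFd, rfl⟩ := hf
    rcases eq_or_ne F 0 with rfl | hF0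
    · rw [initialForm_zero, map_zero, map_zero]
      exact zero_mem _
    obtain ⟨v, hle, hv⟩ := exists_max_weight hF0 ω
    have hsupp : ∀ a ∈ (initialForm ω F).support, a.degree = d' ∧ Finsupp.weight ω a = v := by
      intro a ha
      refine ⟨degree_eq_of_mem_support hFd (initialForm_support_subset ω F ha), ?_⟩
      rw [initialForm_eq hle hv] at ha
      exact (mem_support_of_mem_support_component ha).2
    by_cases h : d' = d ∧ w < v
    · rw [ofCoeffVec_coeffVec]
      · exact Submodule.subset_span ⟨F, hF, h.1 ▸ hFd, rfl, v, h.2, hle, hv⟩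
      · intro a ha
        rw [mem_exponentsAbove, (hsupp a ha).1, (hsupp a ha).2]
        exact h
    · have h0 : coeffVec (exponentsAbove ω d w) (initialForm ω F) = 0 := by
        ext m
        refine notMem_support_iff.1 fun hm => h ?_
        have := mem_exponentsAbove.1 m.2
        rwa [(hsupp m hm).1, (hsupp m hm).2] at this
      rw [h0, map_zero]
      exact zero_mem _
  | zero => rw [map_zero, map_zero]; exact zero_mem _
  | add f g _ _ hf hg => rw [map_add, map_add]; exact add_mem hf hg
  | smul r f _ hf => rw [map_smul, map_smul]; exact Submodule.smul_mem _ r hf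

theorem span_initialFormsAbove_le (ω : Fin n → ℝ) (J : Ideal (MvPolynomial (Fin n) K)) (d : ℕ)
    (w : ℝ) : Submodule.span K (initialFormsAbove ω J d w) ≤
      (initialIdeal ω J).restrictScalars K := by
  rw [Submodule.span_le]
  rintro _ ⟨F, hF, -, rfl, -⟩
  exact Ideal.subset_span ⟨F, hF, rfl⟩

/-- If a unipotent change of coordinates does not increase the coefficient rank of the initial
ideal, the image of the initial ideal has the same coefficient vectors as the image of its part of
high weight. -/
theorem exists_coeffVec_coordChange_eq {ω : Fin n → ℝ} {hω : Antitone ω} {b : GL (Fin n) K}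
    (hb : b ∈ weightBorel K ω hω) {J : Ideal (MvPolynomial (Fin n) K)} (hJ : ComponentClosed J)
    {d : ℕ} {w : ℝ}
    (hrank : coeffRank ((initialIdeal ω J).map (coordChange b)) (exponentsAbove ω d w) ≤
      coeffRank (initialIdeal ω J) (exponentsAbove ω d w))
    {f : MvPolynomial (Fin n) K} (hf : f ∈ initialIdeal ω J) :
    ∃ p ∈ Submodule.span K (initialFormsAbove ω J d w), p.support ⊆ exponentsAbove ω d w ∧
      coeffVec (exponentsAbove ω d w) (coordChange b f) =
        coeffVec (exponentsAbove ω d w) (coordChange b p) := by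
  set T := exponentsAbove ω d w with hT
  let e : (T → K) →ₗ[K] (T → K) := coeffVec T ∘ₗ (coordChange b).toLinearMap ∘ₗ ofCoeffVec T
  -- As `b` preserves the polynomials supported in `T`, reading coefficients at `T` loses nothing
  -- there.
  have he : Function.Injective e := by
    rw [← LinearMap.ker_eq_bot, LinearMap.ker_eq_bot']
    intro v hv
    have h1 : coordChange b (ofCoeffVec T v) = 0 :=
      eq_of_coeffVec_eq (T := T)
        (support_coordChange_subset_exponentsAbove hb (support_ofCoeffVec_subset T v))
        (by simp) (by rw [map_zero]; exact hv)
    rw [map_eq_zero_iff _ (coordChange_injective b)] at h1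
    ext m
    rw [← coeff_ofCoeffVec T v m, h1]
    rfl
  have hle : (((initialIdeal ω J).restrictScalars K).map (coeffVec T)).map e ≤
      (((initialIdeal ω J).map (coordChange b)).restrictScalars K).map (coeffVec T) := by
    rintro _ ⟨_, ⟨q, hq, rfl⟩, rfl⟩
    exact ⟨coordChange b (ofCoeffVec T (coeffVec T q)), Ideal.mem_map_of_mem _
      (span_initialFormsAbove_le ω J d w (ofCoeffVec_mem_span_initialFormsAbove hJ d w hq)), rfl⟩
  -- The left side has the rank of the initial ideal by injectivity, so `hrank` forces equality.
  have heq := Submodule.eq_of_le_of_finrank_le hle (by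
    rw [(Submodule.equivMapOfInjective e he _).symm.finrank_eq]
    exact hrank)
  have hmem : coeffVec T (coordChange b f) ∈
      (((initialIdeal ω J).map (coordChange b)).restrictScalars K).map (coeffVec T) :=
    ⟨coordChange b f, Ideal.mem_map_of_mem _ hf, rfl⟩
  rw [← heq] at hmem
  obtain ⟨_, ⟨q, hq, rfl⟩, h⟩ := hmem
  exact ⟨ofCoeffVec T (coeffVec T q), ofCoeffVec_mem_span_initialFormsAbove hJ d w hq,
    support_ofCoeffVec_subset T _, h.symm⟩

/-- Real weights are not well-ordered, so the induction runs on the number of exponents of degree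
`d` and weight above `w`. -/
theorem coordChange_initialForm_mem {ω : Fin n → ℝ} {hω : Antitone ω} {b : GL (Fin n) K}
    (hb : b ∈ weightBorel K ω hω) {J : Ideal (MvPolynomial (Fin n) K)} (hJ : ComponentClosed J)
    (hrank : ∀ d w, coeffRank ((initialIdeal ω J).map (coordChange b)) (exponentsAbove ω d w) ≤
      coeffRank (initialIdeal ω J) (exponentsAbove ω d w))
    {d : ℕ} (k : ℕ) {F : MvPolynomial (Fin n) K} (hF : F ∈ J) (hFd : F.IsHomogeneous d) {w : ℝ}
    (hle : ∀ a ∈ F.support, Finsupp.weight ω a ≤ w)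
    (hw : ∃ a ∈ F.support, Finsupp.weight ω a = w)
    (hk : (exponentsAbove ω d w).card ≤ k) :
    coordChange b (initialForm ω F) ∈ initialIdeal ω J := by
  classical
  induction k using Nat.strong_induction_on generalizing F w with
  | _ k ih =>
  have hfW : initialForm ω F ∈ initialIdeal ω J := Ideal.subset_span ⟨F, hF, rfl⟩
  obtain ⟨p, hp, hpT, hpeq⟩ := exists_coeffVec_coordChange_eq hb hJ (hrank d w) hfW
  have hsupp : ∀ a ∈ (initialForm ω F).support, Finsupp.weight ω a = w := by
    intro a ha
    rw [initialForm_eq hle hw] at ha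
    exact (mem_support_of_mem_support_component ha).2
  have hfd : (initialForm ω F).IsHomogeneous d :=
    isHomogeneous_of_support_subset hFd (initialForm_support_subset ω F)
  have h0 : coeffVec (exponentsAbove ω d w) (initialForm ω F) = 0 := by
    ext m
    exact notMem_support_iff.1 fun hm => (mem_exponentsAbove.1 m.2).2.ne' (hsupp m hm)
  have hsub : (coordChange b (initialForm ω F) - initialForm ω F).support ⊆
      exponentsAbove ω d w := by
    intro m hm
    obtain ⟨a, ha, hlt⟩ := exists_weight_lt_of_mem_support_coordChange_sub hb _ m hm
    rw [hsupp a ha] at hlt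
    exact mem_exponentsAbove.2 ⟨degree_eq_of_mem_support
      ((isHomogeneous_coordChange b hfd).sub hfd) hm, hlt⟩
  have hdiff : coordChange b (initialForm ω F) - initialForm ω F = coordChange b p :=
    eq_of_coeffVec_eq hsub (support_coordChange_subset_exponentsAbove hb hpT)
      (by rw [map_sub, h0, sub_zero, hpeq])
  rw [← sub_add_cancel (coordChange b (initialForm ω F)) (initialForm ω F), hdiff]
  refine add_mem ?_ hfW
  clear hdiff hpeq hpT
  induction hp using Submodule.span_induction with
  | mem p hp =>
    obtain ⟨G, hG, hGd, rfl, v, hwv, hGle, hGv⟩ := hp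
    refine ih _ (lt_of_lt_of_le ?_ hk) hG hGd hGle hGv le_rfl
    obtain ⟨a, ha, hav⟩ := hGv
    -- An exponent `a` where `G` attains its top weight `v > w` is counted above `w` but not above
    -- `v`.
    refine Finset.card_lt_card (Finset.ssubset_iff_of_subset (fun m hm => ?_) |>.2 ⟨a, ?_, ?_⟩)
    · rw [mem_exponentsAbove] at hm ⊢
      exact ⟨hm.1, hwv.trans hm.2⟩
    · exact mem_exponentsAbove.2 ⟨degree_eq_of_mem_support hGd ha, hav ▸ hwv⟩
    · exact fun h => (mem_exponentsAbove.1 h).2.ne hav.symm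
  | zero => rw [map_zero]; exact zero_mem _
  | add p q _ _ hp hq => rw [map_add]; exact add_mem hp hq
  | smul r p _ hp => rw [map_smul]; exact Submodule.smul_of_tower_mem _ r hp

theorem map_coordChange_initialIdeal_le {ω : Fin n → ℝ} {hω : Antitone ω} {b : GL (Fin n) K}
    (hb : b ∈ weightBorel K ω hω) {J : Ideal (MvPolynomial (Fin n) K)} (hJ : ComponentClosed J)
    (hrank : ∀ d w, coeffRank ((initialIdeal ω J).map (coordChange b)) (exponentsAbove ω d w) ≤
      coeffRank (initialIdeal ω J) (exponentsAbove ω d w)) :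
    (initialIdeal ω J).map (coordChange b) ≤ initialIdeal ω J := by
  rw [Ideal.map_le_iff_le_comap]
  intro f hf
  rw [Ideal.mem_comap]
  change f ∈ (initialIdeal ω J).restrictScalars K at hf
  rw [restrictScalars_initialIdeal hJ] at hf
  induction hf using Submodule.span_induction with
  | mem f hf =>
    obtain ⟨d, F, hF, hFd, rfl⟩ := hf
    rcases eq_or_ne F 0 with rfl | hF0
    · rw [initialForm_zero, map_zero]
      exact zero_mem _
    obtain ⟨w, hle, hw⟩ := exists_max_weight hF0 ω
    exact coordChange_initialForm_mem hb hJ hrank _ hF hFd hle hw le_rfl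
  | zero => rw [map_zero]; exact zero_mem _
  | add f g _ _ hf hg => rw [map_add]; exact add_mem hf hg
  | smul r f _ hf => rw [map_smul]; exact Submodule.smul_of_tower_mem _ r hf

/-- The ranks of `b(in_ω gI)`, a translate of `I`, `gI` and `in_ω gI` increase in this order: by
degeneration, genericity and survival of leading exponents. -/
theorem coeffRank_map_initialIdeal_le [Infinite K] {I : Ideal (MvPolynomial (Fin n) K)}
    (hI : ComponentClosed I) {ω : Fin n → ℝ} {g : GL (Fin n) K} {d : ℕ}
    {T : Finset (Fin n →₀ ℕ)} (hT : IsFinalSegment ω d T) (hg : IsGenericAt I T g)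
    (b : GL (Fin n) K) :
    coeffRank ((initialIdeal ω (I.map (coordChange g))).map (coordChange b)) T ≤
      coeffRank (initialIdeal ω (I.map (coordChange g))) T := by
  have hJ := hI.map_coordChange g
  obtain ⟨h, hh⟩ := exists_coeffRank_initialIdeal_le hJ ω b T
  rw [map_coordChange_mul] at hh
  exact (hh.trans (hg _)).trans (coeffRank_le_of_leadingExponents_subset hT hJ (hJ.initialIdeal ω)
    fun m hm _ => leadingExponents_subset_initialIdeal ω _ m hm)

end WeightInitial

theorem theorem3p2 {K : Type*} [Field K] [Infinite K] (n : ℕ)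
    (I : Ideal (MvPolynomial (Fin n) K))
    (hI : I.IsHomogeneous (MvPolynomial.homogeneousSubmodule (Fin n) K))
    (ω : Fin n → ℝ) (hω : Antitone ω) :
    ∃ U : Set (GL (Fin n) K), U.Nonempty ∧ WeightInitial.IsZariskiOpen U ∧
      ∀ g ∈ U, ∀ b ∈ WeightInitial.weightBorel K ω hω,
        (WeightInitial.initialIdeal ω (I.map (WeightInitial.coordChange g))).map
            (WeightInitial.coordChange b) =
          WeightInitial.initialIdeal ω (I.map (WeightInitial.coordChange g)) := by
  have hI' : WeightInitial.ComponentClosed I := fun f hf d =>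
    homogeneousComponent_mem_of_mem hI hf d
  obtain ⟨P, hP0, hP⟩ := WeightInitial.exists_isGenericAt_isFinalSegment hI' ω
  refine ⟨{g | WeightInitial.evalGL g P ≠ 0}, WeightInitial.exists_evalGL_ne_zero hP0,
    ⟨{P}, by ext g; simp⟩, fun g hg b hb => ?_⟩
  have key : ∀ c ∈ WeightInitial.weightBorel K ω hω,
      (WeightInitial.initialIdeal ω (I.map (WeightInitial.coordChange g))).map
        (WeightInitial.coordChange c) ≤
      WeightInitial.initialIdeal ω (I.map (WeightInitial.coordChange g)) := fun c hc =>
    WeightInitial.map_coordChange_initialIdeal_le hc (hI'.map_coordChange g) fun d w =>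
      WeightInitial.coeffRank_map_initialIdeal_le hI'
        (WeightInitial.isFinalSegment_exponentsAbove ω d w)
        (hP g hg d _ (WeightInitial.isFinalSegment_exponentsAbove ω d w)) c
  -- The reverse inclusion is the same bound applied to `b⁻¹`.
  refine le_antisymm (key b hb) fun f hf => ?_
  rw [← WeightInitial.coordChange_apply_inv b f]
  exact Ideal.mem_map_of_mem _ (key b⁻¹ (inv_mem hb) (Ideal.mem_map_of_mem _ hf))
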